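/- Let $n\ge 1$ and let $\Sigma=(\sigma_{ij})$ be the $n\times n$ signature matrix of a differential-algebraic equation system (DAE) $f_i=0$, $i=1,\dots,n$, in variables $x_1,\dots,x_n$: $\sigma_{ij}\in\{0,1,2,\dots\}$ is the order of the highest derivative of $x_j$ occurring in $f_i$, and $\sigma_{ij}=-\infty$ if $x_j$ does not occur in $f_i$. Assume that the DAE is structurally well-posed, i.e. $\Sigma$ has a transversal (a set of $n$ positions, one in each row and each column) all of whose entries are finite. The value of a transversal is the sum of its entries, and a highest-value transversal (HVT) is one of largest value. *Offsets.* A pair of integer vectors $(c,d)$ is a general offset vector if $d_j-c_i\ge\sigma_{ij}$ for all $i,j$, with equality on some HVT. It is valid if moreover all $c_i\ge 0$, normalised if moreover $\min_i c_i=0$; the canonical offset vector is the elementwise smallest valid one. *Blocks.* Let $A$ be a set of matrix positions. A block-triangular form (BTF) of $A$ is an assignment of the rows and of the columns to blocks $1,\dots,p$ with $N_l\ge1$ rows and $N_l$ columns in block $l$ for each $l$, such that $(i,j)\in A$ implies that the block of row $i$ is at most the block of column $j$. $A$ is irreducible if it contains a transversal and has no BTF with $p>1$. A BTF is irreducible if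 each of its diagonal blocks, as a set of positions in its own right, is irreducible; the blocks, as pairs (set of rows, set of columns), of all irreducible BTFs of $A$ are the same up to order. The fine blocks of the DAE are the blocks of an irreducible BTF of $S_0(c,d)=\{(i,j): d_j-c_i=\sigma_{ij}\}$ for a valid offset vector $(c,d)$ (they do not depend on the choice of $(c,d)$); the coarse blocks are those of an irreducible BTF of $S=\{(i,j):\sigma_{ij}>-\infty\}$. The DAE is fine-block (coarse-block) irreducible if it has only one fine (coarse) block, and reducible otherwise. *Fine-block graph.* Its vertices are the fine blocks. For fine blocks $k,l$ put $W_{kl}=\max\{\sigma_{ij}-\hat d_j+\hat c_i\}$ over the finite $\sigma_{ij}$ with $i$ a row of block $k$ and $j$ a column of block $l$ ($W_{kl}=-\infty$ if there are none), where on each block $(\hat c,\hat d)$ is the canonical offset vector of the corresponding diagonal sub-matrix of $\Sigma$. There is an edge $k\to l$, of weight $W_{kl}$, iff $k\ne l$ and $W_{kl}>-\infty$. The strong components of the graph are its classes of mutually reachable vertices. Then: (i) The set of normalised offset vectors has more than one member iff the fine-block graph has more than one vertex, i.e. iff the DAE is fine-block reducible. (ii) The set of normalised offset vectors is infinite iff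 the fine-block graph has more than one strong component, i.e. iff the DAE is coarse-block reducible. -/

import Mathlib

namespace SigmaMethod

/-- A signature matrix: rows are the equations `f i`, columns the variables `x j`; the entry is the
order of the highest derivative of `x j` occurring in `f i`, and `⊥` (minus infinity) if `x j` does
not occur in `f i`. Rows and columns are labelled by two index types, so that the square part
belonging to a block of equations and variables is again a signature matrix. -/
abbrev SignatureMatrix (ι κ : Type*) := Matrix ι κ (WithBot ℕ)

/-- A sparsity pattern: a set of matrix positions. -/
abbrev Pattern (ι κ : Type*) := Set (ι × κ)

section Offsets

variable {ι κ : Type*}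

/-- The entry of the signature matrix, as an integer or minus infinity. -/
def SignatureMatrix.entry (Sig : SignatureMatrix ι κ) (i : ι) (j : κ) : WithBot ℤ :=
  (Sig i j).map (fun s : ℕ => (s : ℤ))

/-- The value of a transversal. A transversal (a set of positions with exactly one position in each
row and each column) is given by the bijection from rows to columns whose graph it is. -/
def SignatureMatrix.val [Fintype ι] (Sig : SignatureMatrix ι κ) (T : ι ≃ κ) : WithBot ℕ :=
  ∑ i, Sig i (T i)

/-- Highest-value transversal. -/
def SignatureMatrix.IsHVT [Fintype ι] (Sig : SignatureMatrix ι κ) (T : ι ≃ κ) : Prop :=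
  ∀ T' : ι ≃ κ, Sig.val T' ≤ Sig.val T

/-- Structural well-posedness: there is a transversal all of whose entries are finite. -/
def SignatureMatrix.StructurallyWellPosed (Sig : SignatureMatrix ι κ) : Prop :=
  ∃ T : ι ≃ κ, ∀ i, Sig i (T i) ≠ ⊥

/-- General offsets `(c, d)`: `d j - c i ≥ σ i j` everywhere, with equality on some highest-value
transversal. -/
def SignatureMatrix.generalOffsets [Fintype ι] (Sig : SignatureMatrix ι κ) :
    Set ((ι → ℤ) × (κ → ℤ)) :=
  {x | (∀ i j, Sig.entry i j ≤ ((x.2 j - x.1 i : ℤ) : WithBot ℤ)) ∧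
    ∃ T : ι ≃ κ, Sig.IsHVT T ∧ ∀ i, Sig.entry i (T i) = ((x.2 (T i) - x.1 i : ℤ) : WithBot ℤ)}

/-- Valid offsets: general offsets with `c i ≥ 0` for all `i`. -/
def SignatureMatrix.validOffsets [Fintype ι] (Sig : SignatureMatrix ι κ) :
    Set ((ι → ℤ) × (κ → ℤ)) :=
  {x | x ∈ Sig.generalOffsets ∧ ∀ i, 0 ≤ x.1 i}

/-- Normalised offsets: general offsets with `min_i c i = 0`. -/
def SignatureMatrix.normalisedOffsets [Fintype ι] (Sig : SignatureMatrix ι κ) :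
    Set ((ι → ℤ) × (κ → ℤ)) :=
  {x | x ∈ Sig.generalOffsets ∧ IsLeast (Set.range x.1) 0}

open Classical in
/-- The canonical offset vector: the elementwise smallest valid offset vector. -/
noncomputable def SignatureMatrix.canonicalOffset [Fintype ι] (Sig : SignatureMatrix ι κ) :
    (ι → ℤ) × (κ → ℤ) :=
  if h : ∃ x, IsLeast Sig.validOffsets x then h.choose else 0

/-- The sparsity pattern `S` of the signature matrix: the positions of the finite entries. -/
def SignatureMatrix.pattern (Sig : SignatureMatrix ι κ) : Pattern ι κ :=
  {q | Sig q.1 q.2 ≠ ⊥}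

/-- The sparsity pattern `S₀(c, d)` of the Jacobian belonging to the offsets `x = (c, d)`:
the positions with `d j - c i = σ i j`. -/
def SignatureMatrix.jacobianPattern (Sig : SignatureMatrix ι κ) (x : (ι → ℤ) × (κ → ℤ)) :
    Pattern ι κ :=
  {q | ((x.2 q.2 - x.1 q.1 : ℤ) : WithBot ℤ) = Sig.entry q.1 q.2}

end Offsets

section Blocks

/-- A square-block form with `p` blocks, up to the order of rows and of columns inside each block:
every row and every column is assigned to one of the blocks `0, …, p - 1`, each block having equally
many rows and columns, and at least one of each. Listing the rows and the columns block by block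
gives the corresponding permuted matrix. -/
structure BlockForm (ι κ : Type*) (p : ℕ) where
  /-- the block of a row -/
  row : ι → Fin p
  /-- the block of a column -/
  col : κ → Fin p
  row_surjective : Function.Surjective row
  card_eq : ∀ l, Nat.card {i // row i = l} = Nat.card {j // col j = l}

variable {ι κ : Type*} {p : ℕ}

/-- The `l`-th block as the pair of its set of rows and its set of columns. -/
def BlockForm.block (B : BlockForm ι κ p) (l : Fin p) : Set ι × Set κ :=
  ({i | B.row i = l}, {j | B.col j = l})

/-- The form puts the pattern `A` into (upper) block-triangular form. -/
def BlockForm.IsBTF (B : BlockForm ι κ p) (A : Pattern ι κ) : Prop :=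
  ∀ i j, (i, j) ∈ A → B.row i ≤ B.col j

/-- The part of a pattern in the rows and columns of `b`, as a pattern in its own right. -/
def Pattern.restrict (A : Pattern ι κ) (b : Set ι × Set κ) : Pattern b.1 b.2 :=
  {q | ((q.1 : ι), (q.2 : κ)) ∈ A}

/-- A pattern is structurally nonsingular if it contains a transversal. -/
def Pattern.StructurallyNonsingular (A : Pattern ι κ) : Prop :=
  ∃ T : ι ≃ κ, ∀ i, (i, T i) ∈ A

/-- A structurally nonsingular pattern is irreducible if it cannot be permuted to a block-triangular
form with more than one block. -/
def Pattern.Irreducible (A : Pattern ι κ) : Prop :=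
  A.StructurallyNonsingular ∧ ∀ (p : ℕ) (B : BlockForm ι κ p), B.IsBTF A → p ≤ 1

/-- An irreducible block-triangular form: each diagonal block is irreducible. -/
def BlockForm.IsIrreducibleBTF (B : BlockForm ι κ p) (A : Pattern ι κ) : Prop :=
  B.IsBTF A ∧ ∀ l, Pattern.Irreducible (Pattern.restrict A (B.block l))

/-- The blocks of the irreducible block-triangular forms of a pattern. (All such forms have the same
blocks, namely the members of the irreducible emblem of the pattern.) -/
def Pattern.irreducibleBlocks (A : Pattern ι κ) : Set (Set ι × Set κ) :=
  {b | ∃ (p : ℕ) (B : BlockForm ι κ p), B.IsIrreducibleBTF A ∧ ∃ l, B.block l = b}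

/-- The coarse blocks: the blocks of an irreducible block-triangular form of the pattern `S`. -/
def SignatureMatrix.coarseBlocks (Sig : SignatureMatrix ι κ) : Set (Set ι × Set κ) :=
  Pattern.irreducibleBlocks Sig.pattern

/-- The fine blocks: the blocks of an irreducible block-triangular form of a Jacobian pattern
`S₀(c, d)` for valid offsets `(c, d)`. (They do not depend on the choice of `(c, d)`.) -/
def SignatureMatrix.fineBlocks [Fintype ι] (Sig : SignatureMatrix ι κ) : Set (Set ι × Set κ) :=
  {b | ∃ x ∈ Sig.validOffsets, b ∈ Pattern.irreducibleBlocks (Sig.jacobianPattern x)}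

/-- Coarse-block irreducible: there is exactly one coarse block. -/
def SignatureMatrix.CoarseBlockIrreducible (Sig : SignatureMatrix ι κ) : Prop :=
  ∃! b, b ∈ Sig.coarseBlocks

/-- Fine-block irreducible: there is exactly one fine block. -/
def SignatureMatrix.FineBlockIrreducible [Fintype ι] (Sig : SignatureMatrix ι κ) : Prop :=
  ∃! b, b ∈ Sig.fineBlocks

end Blocks

section FineBlockGraph

variable {ι κ : Type*} [Fintype ι] [Fintype κ]

open Classical in
/-- The canonical local offsets of a block `b`: the canonical offset vector of the part of the
signature matrix in the rows and columns of `b`, regarded as a signature matrix in its own right. -/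
noncomputable def SignatureMatrix.localOffset (Sig : SignatureMatrix ι κ) (b : Set ι × Set κ) :
    (b.1 → ℤ) × (b.2 → ℤ) :=
  SignatureMatrix.canonicalOffset
    (Matrix.submatrix Sig (Subtype.val : b.1 → ι) (Subtype.val : b.2 → κ))

open Classical in
/-- The weight `W a b`: the maximum of `σ i j - d̂ j + ĉ i` over the finite entries `σ i j` with `i` a
row of `a` and `j` a column of `b`, where `ĉ`, `d̂` are the canonical local offsets; minus infinity
if there is no such entry. -/
noncomputable def SignatureMatrix.weight (Sig : SignatureMatrix ι κ) (a b : Set ι × Set κ) :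
    WithBot ℤ :=
  (Finset.univ : Finset (a.1 × b.2)).sup fun q =>
    Sig.entry q.1 q.2 +
      (((Sig.localOffset a).1 q.1 - (Sig.localOffset b).2 q.2 : ℤ) : WithBot ℤ)

/-- The fine-block graph: its vertices are the fine blocks, and there is an edge from `a` to `b`
(of weight `W a b`) if `a ≠ b` and `W a b` is finite, that is, if the block inequality
`K b - K a ≥ W a b` is not trivial. -/
noncomputable def SignatureMatrix.fineBlockGraph (Sig : SignatureMatrix ι κ) :
    Digraph Sig.fineBlocks where
  Adj a b := a ≠ b ∧ Sig.weight a b ≠ ⊥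

/-- There is an edge from `a` to `b` exactly if `a ≠ b` and some entry in the rows of `a` and the
columns of `b` is finite. -/
theorem SignatureMatrix.fineBlockGraph_adj_iff (Sig : SignatureMatrix ι κ)
    (a b : Sig.fineBlocks) :
    Sig.fineBlockGraph.Adj a b ↔ a ≠ b ∧ ∃ i ∈ a.1.1, ∃ j ∈ b.1.2, Sig i j ≠ ⊥ := by
  refine and_congr_right fun _ => ?_
  rw [SignatureMatrix.weight, ne_eq, Finset.sup_eq_bot_iff]
  simp [SignatureMatrix.entry, WithBot.map_eq_bot_iff]

end FineBlockGraph

end SigmaMethod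

/-- `v` is reachable from `u` by a (possibly empty) directed path. -/
def Digraph.ReachableFrom {V : Type*} (G : Digraph V) (u v : V) : Prop :=
  Relation.ReflTransGen G.Adj u v

/-- The strong components (as sets of vertices): the classes of mutually reachable vertices. -/
def Digraph.strongComponents {V : Type*} (G : Digraph V) : Set (Set V) :=
  Set.range fun u => {v | G.ReachableFrom u v ∧ G.ReachableFrom v u}

/-! Structural well-posedness gives an offset vector tight on some transversal `T`, by linear
programming duality. Complementary slackness makes every other offset vector tight on this same `T`,
so `d` is determined by `c`. Matching columns to rows by `T` turns a pattern into a digraph on the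
rows, whose strong components are the irreducible blocks.

For offsets `x`, `y`, the shift `y.1 - x.1` cannot decrease along an arc of `S₀(x)`. If `S₀(x)` is
strongly connected, the shift is constant and normalisation makes it zero; if `k` is unreachable
from `i`, raising the offsets by 1 on everything reachable from `i` gives a second normalised
vector. An arc of `S` only bounds a difference of the `c`'s from below: strong connectivity of `S`
confines normalised vectors to a finite box, while an unreachable row permits raises of every size.
Since `S₀ ⊆ S`, contracting the fine blocks preserves reachability in `S`, which links the
fine-block graph to the coarse blocks. -/

namespace SigmaMethod

/-! ### Irreducible blocks as strong components -/

section Patterns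

variable {ι κ : Type*} {p : ℕ}

/-- Row `k` is reachable from row `i` in the digraph on the rows with an arc `i → k` for each
position `(i, T k)` of the pattern. -/
def Pattern.Reach (A : Pattern ι κ) (T : ι ≃ κ) : ι → ι → Prop :=
  Relation.ReflTransGen fun i k => (i, T k) ∈ A

/-- The strong component of row `i`, with the columns matched to its rows by `T`. -/
def Pattern.strongBlock (A : Pattern ι κ) (T : ι ≃ κ) (i : ι) : Set ι × Set κ :=
  ({k | A.Reach T i k ∧ A.Reach T k i}, {j | A.Reach T i (T.symm j) ∧ A.Reach T (T.symm j) i})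

theorem Pattern.strongBlock_eq_iff {A : Pattern ι κ} {T : ι ≃ κ} {i k : ι} :
    A.strongBlock T i = A.strongBlock T k ↔ A.Reach T i k ∧ A.Reach T k i := by
  constructor
  · intro h
    have : k ∈ (A.strongBlock T k).1 := ⟨.refl, .refl⟩
    rwa [← h] at this
  · rintro ⟨hik, hki⟩
    have h : ∀ m, A.Reach T i m ∧ A.Reach T m i ↔ A.Reach T k m ∧ A.Reach T m k := fun m =>
      ⟨fun h => ⟨hki.trans h.1, h.2.trans hik⟩, fun h => ⟨hik.trans h.1, h.2.trans hki⟩⟩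
    exact Prod.ext (Set.ext fun m => h m) (Set.ext fun j => h (T.symm j))

/-- The block form in which each column lies in the block of the row matched to it. -/
def BlockForm.ofRow (T : ι ≃ κ) (f : ι → Fin p) (hf : Function.Surjective f) :
    BlockForm ι κ p where
  row := f
  col j := f (T.symm j)
  row_surjective := hf
  card_eq l := Nat.card_congr (T.subtypeEquiv fun i => by simp)

/-- Block indices cannot decrease from row to column along a transversal in `A`, yet both sums of
indices agree because each block is square; so no index increases. -/
theorem BlockForm.IsBTF.col_eq_row [Finite ι] {A : Pattern ι κ} {B : BlockForm ι κ p}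
    (hB : B.IsBTF A) {T : ι ≃ κ} (hT : ∀ i, (i, T i) ∈ A) (i : ι) : B.col (T i) = B.row i := by
  have : Finite κ := .of_equiv _ T
  have := Fintype.ofFinite ι
  have := Fintype.ofFinite κ
  let E := fun l => (Finite.card_eq.1 (B.card_eq l)).some
  let e : ι ≃ κ := (Equiv.sigmaFiberEquiv B.row).symm.trans
    ((Equiv.sigmaCongrRight E).trans
      (Equiv.sigmaFiberEquiv B.col))
  have he : ∀ i, B.col (e i) = B.row i := fun i =>
    (E (B.row i) ⟨i, rfl⟩).2
  have hsum : ∑ i, (B.row i : ℕ) = ∑ i, (B.col (T i) : ℕ) := by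
    rw [Equiv.sum_comp T fun j => (B.col j : ℕ), ← Equiv.sum_comp e fun j => (B.col j : ℕ)]
    simp only [he]
  have h := (Finset.sum_eq_sum_iff_of_le fun i _ => Fin.le_def.1 (hB i (T i) (hT i))).1 hsum
  exact (Fin.ext (h i (Finset.mem_univ i))).symm

theorem BlockForm.IsBTF.row_le_row [Finite ι] {A : Pattern ι κ} {B : BlockForm ι κ p}
    (hB : B.IsBTF A) {T : ι ≃ κ} (hT : ∀ i, (i, T i) ∈ A) {i k : ι} (h : A.Reach T i k) :
    B.row i ≤ B.row k := by
  induction h with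
  | refl => exact le_rfl
  | tail _ h ih => exact ih.trans ((hB _ _ h).trans_eq (hB.col_eq_row hT _))

theorem Pattern.irreducible_iff_reach [Finite ι] {A : Pattern ι κ} {T : ι ≃ κ}
    (hT : ∀ i, (i, T i) ∈ A) : A.Irreducible ↔ ∀ i k, A.Reach T i k := by
  classical
  constructor
  · intro h i k
    by_contra hik
    -- The set reachable from `i` is closed under arcs, so it can serve as the last block of a
    -- two-block form.
    let f : ι → Fin 2 := fun m => if A.Reach T i m then 1 else 0
    have hf : Function.Surjective f := by
      intro l
      fin_cases l
      · exact ⟨k, if_neg hik⟩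
      · exact ⟨i, if_pos .refl⟩
    have := h.2 2 (BlockForm.ofRow T f hf) fun a j haj => by
      change f a ≤ f (T.symm j)
      by_cases ha : A.Reach T i a
      · have : A.Reach T i (T.symm j) := ha.tail (by simpa using haj)
        simp [f, ha, this]
      · simp [f, ha]
    omega
  · refine fun h => ⟨⟨T, hT⟩, fun p B hB => ?_⟩
    have : Subsingleton (Fin p) := ⟨fun l m => by
      obtain ⟨i, rfl⟩ := B.row_surjective l
      obtain ⟨k, rfl⟩ := B.row_surjective m
      exact le_antisymm (hB.row_le_row hT (h i k)) (hB.row_le_row hT (h k i))⟩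
    exact Fin.subsingleton_iff_le_one.1 this

theorem Pattern.reach_of_reach_restrict {A : Pattern ι κ} {T : ι ≃ κ} {b : Set ι × Set κ}
    (hb : ∀ i, i ∈ b.1 ↔ T i ∈ b.2) {i k : b.1}
    (h : (A.restrict b).Reach (T.subtypeEquiv hb) i k) : A.Reach T i k :=
  Relation.ReflTransGen.lift (p := fun i k => (i, T k) ∈ A) Subtype.val (fun _ _ h => h) _ _ h

/-- Convexity of the block keeps every intermediate row of the path inside it. -/
theorem Pattern.Reach.restrict {A : Pattern ι κ} {T : ι ≃ κ} {b : Set ι × Set κ}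
    (hb : ∀ i, i ∈ b.1 ↔ T i ∈ b.2)
    (hconv : ∀ i ∈ b.1, ∀ k ∈ b.1, ∀ m, A.Reach T i m → A.Reach T m k → m ∈ b.1) {i k : ι}
    (h : A.Reach T i k) (hi : i ∈ b.1) (hk : k ∈ b.1) :
    (A.restrict b).Reach (T.subtypeEquiv hb) ⟨i, hi⟩ ⟨k, hk⟩ := by
  induction h using Relation.ReflTransGen.head_induction_on with
  | refl => exact .refl
  | head h h' ih =>
    have hm := hconv _ hi _ hk _ (.single h) h'
    exact Relation.ReflTransGen.head (b := (⟨_, hm⟩ : b.1)) (show (_, T _) ∈ A from h) (ih hm)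

/-- Reachability is a preorder; a linear extension of its quotient partial order numbers the strong
components. -/
theorem Pattern.exists_topological_order [Finite ι] (A : Pattern ι κ) (T : ι ≃ κ) :
    ∃ (p : ℕ) (f : ι → Fin p), Function.Surjective f ∧
      (∀ i k, A.Reach T i k → f i ≤ f k) ∧
      ∀ i k, f i = f k → A.Reach T i k ∧ A.Reach T k i := by
  let : Preorder ι :=
    { le := A.Reach T, le_refl := fun _ => .refl, le_trans := fun _ _ _ h h' => h.trans h' }
  let L := LinearExtension (Antisymmetrization ι (· ≤ ·))
  have : Finite L := Quotient.finite _
  have := Fintype.ofFinite L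
  let e : L ≃o Fin (Fintype.card L) := (Fintype.orderIsoFinOfCardEq L rfl).symm
  let g : ι → L := fun i => toLinearExtension (toAntisymmetrization (· ≤ ·) i)
  refine ⟨_, fun i => e (g i), e.surjective.comp ?_, fun i k h => ?_, fun i k h => ?_⟩
  · exact Quotient.mk_surjective
  · exact e.monotone (toLinearExtension.monotone (toAntisymmetrization_mono h))
  · have h : toAntisymmetrization (· ≤ ·) i = toAntisymmetrization (· ≤ ·) k := e.injective h
    exact Quotient.exact h

theorem Pattern.irreducibleBlocks_eq_range [Finite ι] {A : Pattern ι κ} {T : ι ≃ κ}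
    (hT : ∀ i, (i, T i) ∈ A) : A.irreducibleBlocks = Set.range (A.strongBlock T) := by
  ext b
  constructor
  · rintro ⟨p, B, ⟨hB, hirr⟩, l, rfl⟩
    have hb : ∀ i, i ∈ (B.block l).1 ↔ T i ∈ (B.block l).2 := fun i => by
      simp [BlockForm.block, hB.col_eq_row hT]
    obtain ⟨i, hi⟩ := B.row_surjective l
    have hl := (Pattern.irreducible_iff_reach (T := T.subtypeEquiv hb) fun i => hT i).1 (hirr l)
    have key : ∀ k, A.Reach T i k ∧ A.Reach T k i ↔ B.row k = l := fun k => by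
      constructor
      · rintro ⟨h, h'⟩
        rw [← hi]
        exact le_antisymm (hB.row_le_row hT h') (hB.row_le_row hT h)
      · exact fun hk => ⟨Pattern.reach_of_reach_restrict hb (hl ⟨i, hi⟩ ⟨k, hk⟩),
          Pattern.reach_of_reach_restrict hb (hl ⟨k, hk⟩ ⟨i, hi⟩)⟩
    refine ⟨i, Prod.ext (Set.ext key) (Set.ext fun j => (key _).trans ?_)⟩
    rw [← hB.col_eq_row hT, T.apply_symm_apply]
    rfl
  · rintro ⟨i, rfl⟩
    obtain ⟨p, f, hf, hmono, hstrong⟩ := A.exists_topological_order T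
    have key : ∀ i k, f k = f i ↔ A.Reach T i k ∧ A.Reach T k i := fun i k =>
      ⟨fun h => hstrong _ _ h.symm, fun h => le_antisymm (hmono _ _ h.2) (hmono _ _ h.1)⟩
    refine ⟨p, .ofRow T f hf, ⟨fun a j h => ?_, fun l => ?_⟩, f i, ?_⟩
    · exact hmono _ _ (.single (by simpa using h))
    · have hb : ∀ i, i ∈ ((BlockForm.ofRow T f hf).block l).1 ↔
          T i ∈ ((BlockForm.ofRow T f hf).block l).2 := fun i => by
        simp [BlockForm.block, BlockForm.ofRow]
      refine (Pattern.irreducible_iff_reach (T := T.subtypeEquiv hb) fun i => hT i).2 ?_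
      rintro ⟨a, ha⟩ ⟨c, hc⟩
      refine Pattern.Reach.restrict hb ?_ ((key a c).1 (hc.trans ha.symm)).1 ha hc
      intro a ha c hc m ham hmc
      exact le_antisymm ((hmono _ _ hmc).trans_eq hc) (ha.symm.trans_le (hmono _ _ ham))
    · exact Prod.ext (Set.ext fun k => key i k) (Set.ext fun j => key i (T.symm j))

theorem Pattern.nontrivial_range_strongBlock_iff {A : Pattern ι κ} {T : ι ≃ κ} :
    (Set.range (A.strongBlock T)).Nontrivial ↔ ∃ i k, ¬ A.Reach T i k := by
  constructor
  · rintro ⟨_, ⟨i, rfl⟩, _, ⟨k, rfl⟩, hne⟩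
    rw [ne_eq, Pattern.strongBlock_eq_iff] at hne
    by_contra! h
    exact hne ⟨h i k, h k i⟩
  · rintro ⟨i, k, h⟩
    exact ⟨_, ⟨i, rfl⟩, _, ⟨k, rfl⟩, fun he => h (Pattern.strongBlock_eq_iff.1 he).1⟩

end Patterns

end SigmaMethod

/-! ### Having more than one block or strong component -/

theorem Set.Nonempty.nontrivial_iff_not_existsUnique {α : Type*} {s : Set α} (hs : s.Nonempty) :
    s.Nontrivial ↔ ¬ ∃! a, a ∈ s := by
  rw [← Set.not_subsingleton_iff, not_iff_not]
  obtain ⟨a, ha⟩ := hs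
  exact ⟨fun h => ⟨a, ha, fun b hb => h hb ha⟩, fun h b hb c hc => h.unique hb hc⟩

theorem Digraph.strongComponents_nontrivial_iff {V : Type*} (G : Digraph V) :
    G.strongComponents.Nontrivial ↔ ∃ u v, ¬ G.ReachableFrom u v := by
  constructor
  · rintro ⟨_, ⟨u, rfl⟩, _, ⟨v, rfl⟩, hne⟩
    by_contra! h
    exact hne (Set.ext fun w => by simp [h])
  · rintro ⟨u, v, h⟩
    refine ⟨_, ⟨u, rfl⟩, _, ⟨v, rfl⟩, fun he => h ?_⟩
    exact (he.ge ⟨.refl, .refl⟩ : v ∈ {w | G.ReachableFrom u w ∧ G.ReachableFrom w u}).1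

namespace SigmaMethod

/-! ### Offsets as dual solutions of the assignment problem -/

section FeasibleOffsets

variable {ι κ : Type*} {Sig : SignatureMatrix ι κ} {x y : (ι → ℤ) × (κ → ℤ)} {T : ι ≃ κ}

/-- The inequalities `d j - c i ≥ σ i j`. -/
def SignatureMatrix.Feasible (Sig : SignatureMatrix ι κ) (x : (ι → ℤ) × (κ → ℤ)) : Prop :=
  ∀ i j, Sig.entry i j ≤ ((x.2 j - x.1 i : ℤ) : WithBot ℤ)

/-- The equalities `d j - c i = σ i j` on the transversal `T`. -/
def SignatureMatrix.Tight (Sig : SignatureMatrix ι κ) (x : (ι → ℤ) × (κ → ℤ)) (T : ι ≃ κ) : Prop :=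
  ∀ i, Sig.entry i (T i) = ((x.2 (T i) - x.1 i : ℤ) : WithBot ℤ)

theorem SignatureMatrix.entry_eq_bot_iff {i : ι} {j : κ} : Sig.entry i j = ⊥ ↔ Sig i j = ⊥ :=
  WithBot.map_eq_bot_iff

theorem SignatureMatrix.Tight.mem_jacobianPattern (h : Sig.Tight x T) (i : ι) :
    (i, T i) ∈ Sig.jacobianPattern x :=
  (h i).symm

theorem SignatureMatrix.jacobianPattern_subset_pattern :
    Sig.jacobianPattern x ⊆ Sig.pattern := fun q h hbot => by
  have h : ((x.2 q.2 - x.1 q.1 : ℤ) : WithBot ℤ) = Sig.entry q.1 q.2 := h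
  rw [SignatureMatrix.entry_eq_bot_iff.2 hbot] at h
  exact WithBot.coe_ne_bot h

theorem SignatureMatrix.Feasible.entry_le_sub_one (hx : Sig.Feasible x) {i : ι} {j : κ}
    (h : (i, j) ∉ Sig.jacobianPattern x) :
    Sig.entry i j ≤ ((x.2 j - x.1 i - 1 : ℤ) : WithBot ℤ) := by
  have h1 : Sig.entry i j < ((x.2 j - x.1 i : ℤ) : WithBot ℤ) :=
    lt_of_le_of_ne (hx i j) fun he => h he.symm
  revert h1
  induction Sig.entry i j with
  | bot => exact fun _ => bot_le
  | coe z =>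
    intro h1
    have := WithBot.coe_lt_coe.1 h1
    exact WithBot.coe_le_coe.2 (by omega)

theorem SignatureMatrix.Feasible.sub_le_sub_of_reach (hy : Sig.Feasible y) (hx : Sig.Tight x T)
    (hyT : Sig.Tight y T) {i k : ι} (h : (Sig.jacobianPattern x).Reach T i k) :
    y.1 i - x.1 i ≤ y.1 k - x.1 k := by
  induction h with
  | refl => exact le_rfl
  | @tail a b _ h ih =>
    have h : ((x.2 (T b) - x.1 a : ℤ) : WithBot ℤ) = Sig.entry a (T b) := h
    have h1 := WithBot.coe_le_coe.1 (h.trans_le (hy a (T b)))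
    have h2 := WithBot.coe_inj.1 ((hx b).symm.trans (hyT b))
    omega

/-- On a closed walk in `S₀(x)` the monotone shift is constant, so its arcs are tight for `y` too.
Hence fine blocks do not depend on the offsets. -/
theorem SignatureMatrix.Feasible.reach_of_reach (hy : Sig.Feasible y) (hx : Sig.Tight x T)
    (hyT : Sig.Tight y T) {i k : ι} (h : (Sig.jacobianPattern x).Reach T i k)
    (h' : (Sig.jacobianPattern x).Reach T k i) : (Sig.jacobianPattern y).Reach T i k := by
  induction h with
  | refl => exact .refl
  | @tail a b hia h ih =>
    refine .tail (ih (.head h h')) ?_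
    have h1 := hy.sub_le_sub_of_reach hx hyT (.single h)
    have h2 := hy.sub_le_sub_of_reach hx hyT (h'.trans hia)
    have h3 := WithBot.coe_inj.1 ((hx b).symm.trans (hyT b))
    have h : ((x.2 (T b) - x.1 a : ℤ) : WithBot ℤ) = Sig.entry a (T b) := h
    change ((y.2 (T b) - y.1 a : ℤ) : WithBot ℤ) = Sig.entry a (T b)
    rw [← h]
    congr 1
    omega

theorem SignatureMatrix.exists_le_sub_of_reach {i k : ι} (h : Sig.pattern.Reach T i k) :
    ∃ L : ℤ, ∀ x, Sig.Feasible x → Sig.Tight x T → L ≤ x.1 k - x.1 i := by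
  induction h with
  | refl => exact ⟨0, fun x _ _ => by simp⟩
  | @tail a b _ h ih =>
    obtain ⟨L, hL⟩ := ih
    obtain ⟨z, hz⟩ := WithBot.ne_bot_iff_exists.1 (mt SignatureMatrix.entry_eq_bot_iff.1 h)
    -- Subtracting tightness at `(b, T b)` from feasibility at `(a, T b)` eliminates `d`. The
    -- default 0 is never used: tightness makes the entry finite.
    refine ⟨L + z - (Sig.entry b (T b)).unbotD 0, fun x hx hT => ?_⟩
    have h1 := hL x hx hT
    have h2 := WithBot.coe_le_coe.1 (hz.trans_le (hx a (T b)))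
    rw [hT b, WithBot.unbotD_coe]
    omega

variable [Fintype ι]

theorem SignatureMatrix.map_val (Sig : SignatureMatrix ι κ) (T : ι ≃ κ) :
    (Sig.val T).map (fun s : ℕ => (s : ℤ)) = ∑ i, Sig.entry i (T i) :=
  map_sum (Nat.castAddMonoidHom ℤ).withBotMap _ _

theorem SignatureMatrix.val_le_val_iff {T T' : ι ≃ κ} :
    Sig.val T ≤ Sig.val T' ↔ ∑ i, Sig.entry i (T i) ≤ ∑ i, Sig.entry i (T' i) := by
  rw [← Sig.map_val, ← Sig.map_val, WithBot.map_le_iff _ Nat.cast_le]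

theorem SignatureMatrix.exists_feasible (Sig : SignatureMatrix ι κ) : ∃ x, Sig.Feasible x := by
  refine ⟨(0, fun j => ((∑ i, (Sig i j).unbotD 0 : ℕ) : ℤ)), fun i j => ?_⟩
  have h : (Sig i j).unbotD 0 ≤ ∑ i, (Sig i j).unbotD 0 :=
    Finset.single_le_sum (f := fun i => (Sig i j).unbotD 0) (fun _ _ => Nat.zero_le _)
      (Finset.mem_univ i)
  change (Sig i j).map _ ≤ ((((∑ i, (Sig i j).unbotD 0 : ℕ) : ℤ) - 0 : ℤ) : WithBot ℤ)
  revert h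
  generalize ∑ i, (Sig i j).unbotD 0 = s
  induction Sig i j with
  | bot => exact fun _ => bot_le
  | coe a =>
    intro h
    exact WithBot.coe_le_coe.2 (by simpa using h)

variable [Fintype κ]

theorem SignatureMatrix.Feasible.sum_entry_le (hx : Sig.Feasible x) (T : ι ≃ κ) :
    ∑ i, Sig.entry i (T i) ≤ ((∑ j, x.2 j - ∑ i, x.1 i : ℤ) : WithBot ℤ) := by
  refine (Finset.sum_le_sum fun i _ => hx i (T i)).trans_eq ?_
  rw [← WithBot.coe_sum, Finset.sum_sub_distrib, Equiv.sum_comp T]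

theorem SignatureMatrix.Tight.sum_entry_eq (hT : Sig.Tight x T) :
    ∑ i, Sig.entry i (T i) = ((∑ j, x.2 j - ∑ i, x.1 i : ℤ) : WithBot ℤ) := by
  rw [Finset.sum_congr rfl fun i _ => hT i, ← WithBot.coe_sum, Finset.sum_sub_distrib,
    Equiv.sum_comp T]

theorem SignatureMatrix.Tight.isHVT (hx : Sig.Feasible x) (hT : Sig.Tight x T) : Sig.IsHVT T :=
  fun T' => SignatureMatrix.val_le_val_iff.2 ((hx.sum_entry_le T').trans_eq hT.sum_entry_eq.symm)

theorem SignatureMatrix.mem_generalOffsets_iff :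
    x ∈ Sig.generalOffsets ↔ Sig.Feasible x ∧ ∃ T, Sig.Tight x T :=
  ⟨fun ⟨h, T, _, hT⟩ => ⟨h, T, hT⟩, fun ⟨h, T, hT⟩ => ⟨h, T, hT.isHVT h, hT⟩⟩

/-- Complementary slackness: the value of `T'` attains the dual bound `∑ d - ∑ c`, so each termwise
inequality is an equality. -/
theorem SignatureMatrix.Tight.of_isHVT {T' : ι ≃ κ} (hx : Sig.Feasible x) (hT : Sig.Tight x T)
    (hT' : Sig.IsHVT T') : Sig.Tight x T' := by
  have hsum : ∑ i, Sig.entry i (T' i) = ((∑ j, x.2 j - ∑ i, x.1 i : ℤ) : WithBot ℤ) :=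
    le_antisymm (hx.sum_entry_le T')
      (hT.sum_entry_eq.ge.trans (SignatureMatrix.val_le_val_iff.1 (hT' T)))
  have hne : ∀ i, Sig.entry i (T' i) ≠ ⊥ := fun i hi => by
    rw [WithBot.sum_eq_bot_iff.2 ⟨i, Finset.mem_univ i, hi⟩] at hsum
    exact WithBot.coe_ne_bot hsum.symm
  choose z hz using fun i => WithBot.ne_bot_iff_exists.1 (hne i)
  have hle : ∀ i, z i ≤ x.2 (T' i) - x.1 i := fun i =>
    WithBot.coe_le_coe.1 ((hz i).trans_le (hx i (T' i)))
  simp only [← hz] at hsum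
  rw [← WithBot.coe_sum, WithBot.coe_inj, ← Equiv.sum_comp T', ← Finset.sum_sub_distrib,
    Finset.sum_eq_sum_iff_of_le fun i _ => hle i] at hsum
  intro i
  rw [← hz, hsum i (Finset.mem_univ i)]

theorem SignatureMatrix.tight_of_mem_generalOffsets (hx : Sig.Feasible x) (hT : Sig.Tight x T)
    (hy : y ∈ Sig.generalOffsets) : Sig.Tight y T := by
  obtain ⟨hyf, T', hT'⟩ := SignatureMatrix.mem_generalOffsets_iff.1 hy
  exact hT'.of_isHVT hyf (hT.isHVT hx)

/-- Minimise `∑ d - ∑ c` over feasible vectors; the finite transversal bounds it below. At a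
minimum, Hall's condition holds in `S₀`, which yields a tight transversal. -/
theorem SignatureMatrix.StructurallyWellPosed.generalOffsets_nonempty
    (h : Sig.StructurallyWellPosed) : Sig.generalOffsets.Nonempty := by
  classical
  obtain ⟨T, hT⟩ := h
  choose z hz using fun i => WithBot.ne_bot_iff_exists.1
    (mt SignatureMatrix.entry_eq_bot_iff.1 (hT i))
  let P : ℤ → Prop := fun v => ∃ x, Sig.Feasible x ∧ v = ∑ j, x.2 j - ∑ i, x.1 i
  obtain ⟨_, ⟨x, hx, rfl⟩, hmin⟩ := Int.exists_least_of_bdd (P := P)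
    ⟨∑ i, z i, by
      rintro _ ⟨x, hx, rfl⟩
      have := hx.sum_entry_le T
      simp only [← hz] at this
      rwa [← WithBot.coe_sum, WithBot.coe_le_coe] at this⟩
    (Sig.exists_feasible.elim fun x hx => ⟨_, x, hx, rfl⟩)
  have hall : ∀ R : Finset ι, R.card ≤
      (Finset.univ.filter fun j => ∃ i ∈ R, (i, j) ∈ Sig.jacobianPattern x).card := by
    intro R
    set N := Finset.univ.filter fun j => ∃ i ∈ R, (i, j) ∈ Sig.jacobianPattern x with hN
    -- Raising `c` on `R` and `d` on its neighbours `N` stays feasible, since entries outside `S₀`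
    -- have slack at least 1. The objective changes by `|N| - |R|`, which minimality makes
    -- nonnegative.
    have hle := hmin _ ⟨(fun i => x.1 i + if i ∈ R then 1 else 0,
      fun j => x.2 j + if j ∈ N then 1 else 0), fun i j => ?_, rfl⟩
    · simp only [Finset.sum_add_distrib, Finset.sum_boole, Finset.filter_univ_mem] at hle
      omega
    · by_cases hi : i ∈ R <;> by_cases hj : j ∈ N
      · simpa [hi, hj] using hx i j
      · have : (i, j) ∉ Sig.jacobianPattern x := fun hij => hj (by simpa [hN] using ⟨i, hi, hij⟩)
        refine (hx.entry_le_sub_one this).trans (WithBot.coe_le_coe.2 ?_)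
        simp only [hi, hj, if_true, if_false]
        omega
      all_goals
        refine (hx i j).trans (WithBot.coe_le_coe.2 ?_)
        simp only [hi, hj, if_true, if_false]
        omega
  obtain ⟨f, hf, hfx⟩ := (Fintype.all_card_le_filter_rel_iff_exists_injective
    fun i j => (i, j) ∈ Sig.jacobianPattern x).1 hall
  have hbij := (Fintype.bijective_iff_injective_and_card f).2 ⟨hf, Fintype.card_congr T⟩
  exact ⟨x, SignatureMatrix.mem_generalOffsets_iff.2
    ⟨hx, Equiv.ofBijective f hbij, fun i => (hfx i).symm⟩⟩

theorem SignatureMatrix.exists_normalisedOffset [Nonempty ι] (hx : x ∈ Sig.generalOffsets) :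
    ∃ y ∈ Sig.normalisedOffsets, ∀ i k, y.1 i - y.1 k = x.1 i - x.1 k := by
  obtain ⟨i₀, hi₀⟩ := Finite.exists_min x.1
  obtain ⟨hf, T, hT⟩ := SignatureMatrix.mem_generalOffsets_iff.1 hx
  refine ⟨(fun i => x.1 i - x.1 i₀, fun j => x.2 j - x.1 i₀),
    ⟨SignatureMatrix.mem_generalOffsets_iff.2 ⟨fun i j => ?_, T, fun i => ?_⟩,
      ⟨i₀, sub_self _⟩, ?_⟩, fun i k => sub_sub_sub_cancel_right _ _ _⟩
  · simpa using hf i j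
  · simpa using hT i
  · rintro _ ⟨i, rfl⟩
    exact sub_nonneg.2 (hi₀ i)

/-- Raising the offsets by `m` on a set `U` of rows containing `i` but not `k`, and on the matching
columns. -/
theorem SignatureMatrix.exists_normalisedOffset_shift (hx : Sig.Feasible x) (hT : Sig.Tight x T)
    {U : Set ι} {i k : ι} (hi : i ∈ U) (hk : k ∉ U) {m : ℤ} (hm : 0 ≤ m)
    (hU : ∀ a ∈ U, ∀ b ∉ U, Sig.entry a (T b) ≤ ((x.2 (T b) - x.1 a - m : ℤ) : WithBot ℤ)) :
    ∃ y ∈ Sig.normalisedOffsets, y.1 i - y.1 k = x.1 i - x.1 k + m := by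
  classical
  have : Nonempty ι := ⟨i⟩
  let y : (ι → ℤ) × (κ → ℤ) := (fun a => x.1 a + if a ∈ U then m else 0,
    fun j => x.2 j + if T.symm j ∈ U then m else 0)
  have hy : y ∈ Sig.generalOffsets := by
    refine SignatureMatrix.mem_generalOffsets_iff.2 ⟨fun a j => ?_, T, fun a => ?_⟩
    · obtain ⟨b, rfl⟩ := T.surjective j
      by_cases ha : a ∈ U <;> by_cases hb : b ∈ U
      · simpa [y, ha, hb] using hx a (T b)
      · refine (hU a ha b hb).trans (WithBot.coe_le_coe.2 ?_)
        simp only [y, ha, hb, Equiv.symm_apply_apply, if_true, if_false]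
        omega
      all_goals
        refine (hx a (T b)).trans (WithBot.coe_le_coe.2 ?_)
        simp only [y, ha, hb, Equiv.symm_apply_apply, if_true, if_false]
        omega
    · simpa [y] using hT a
  obtain ⟨z, hz, hzy⟩ := SignatureMatrix.exists_normalisedOffset hy
  refine ⟨z, hz, (hzy i k).trans ?_⟩
  simp only [y, hi, hk, if_true, if_false]
  omega

end FeasibleOffsets

/-! ### Counting normalised offsets by reachability -/

section Blocks

variable {ι κ : Type*} {Sig : SignatureMatrix ι κ} {x : (ι → ℤ) × (κ → ℤ)} {T : ι ≃ κ}

theorem SignatureMatrix.strongBlock_jacobianPattern_eq {y : (ι → ℤ) × (κ → ℤ)}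
    (hx : Sig.Feasible x) (hy : Sig.Feasible y) (hxT : Sig.Tight x T) (hyT : Sig.Tight y T) :
    (Sig.jacobianPattern y).strongBlock T = (Sig.jacobianPattern x).strongBlock T := by
  have h : ∀ i k, ((Sig.jacobianPattern y).Reach T i k ∧ (Sig.jacobianPattern y).Reach T k i) ↔
      ((Sig.jacobianPattern x).Reach T i k ∧ (Sig.jacobianPattern x).Reach T k i) := fun i k =>
    ⟨fun h => ⟨hx.reach_of_reach hyT hxT h.1 h.2, hx.reach_of_reach hyT hxT h.2 h.1⟩,
      fun h => ⟨hy.reach_of_reach hxT hyT h.1 h.2, hy.reach_of_reach hxT hyT h.2 h.1⟩⟩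
  exact funext fun i => Prod.ext (Set.ext fun k => h i k) (Set.ext fun j => h i (T.symm j))

theorem SignatureMatrix.coarseBlocks_eq_range [Finite ι] (hT : Sig.Tight x T) :
    Sig.coarseBlocks = Set.range (Sig.pattern.strongBlock T) :=
  Pattern.irreducibleBlocks_eq_range fun i =>
    SignatureMatrix.jacobianPattern_subset_pattern (hT.mem_jacobianPattern i)

variable [Fintype ι] [Fintype κ]

theorem SignatureMatrix.fineBlocks_eq_range (hx : Sig.Feasible x) (hT : Sig.Tight x T)
    (hx0 : ∀ i, 0 ≤ x.1 i) :
    Sig.fineBlocks = Set.range ((Sig.jacobianPattern x).strongBlock T) := by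
  ext b
  constructor
  · rintro ⟨y, ⟨hy, _⟩, hb⟩
    have hyT := SignatureMatrix.tight_of_mem_generalOffsets hx hT hy
    rw [Pattern.irreducibleBlocks_eq_range hyT.mem_jacobianPattern,
      SignatureMatrix.strongBlock_jacobianPattern_eq hx hy.1 hT hyT] at hb
    exact hb
  · intro hb
    rw [← Pattern.irreducibleBlocks_eq_range hT.mem_jacobianPattern] at hb
    exact ⟨x, ⟨SignatureMatrix.mem_generalOffsets_iff.2 ⟨hx, T, hT⟩, hx0⟩, hb⟩

theorem SignatureMatrix.normalisedOffsets_nontrivial_iff (hx : Sig.Feasible x)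
    (hT : Sig.Tight x T) : Sig.normalisedOffsets.Nontrivial ↔
      ∃ i k, ¬ (Sig.jacobianPattern x).Reach T i k := by
  constructor
  · rintro ⟨y, ⟨hy, hy0⟩, z, ⟨hz, hz0⟩, hne⟩
    by_contra! h
    have hyT := SignatureMatrix.tight_of_mem_generalOffsets hx hT hy
    have hzT := SignatureMatrix.tight_of_mem_generalOffsets hx hT hz
    have hsub : ∀ i k, z.1 i - z.1 k = y.1 i - y.1 k := fun i k => by
      have h1 := Feasible.sub_le_sub_of_reach hz.1 hT hzT (h i k)
      have h2 := Feasible.sub_le_sub_of_reach hz.1 hT hzT (h k i)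
      have h3 := Feasible.sub_le_sub_of_reach hy.1 hT hyT (h i k)
      have h4 := Feasible.sub_le_sub_of_reach hy.1 hT hyT (h k i)
      omega
    obtain ⟨⟨a, ha⟩, ha0⟩ := hy0
    obtain ⟨⟨b, hb⟩, hb0⟩ := hz0
    -- The two vectors differ by a constant, and both have minimum zero.
    have hc : ∀ i, y.1 i = z.1 i := fun i => by
      have h1 := ha0 ⟨b, rfl⟩
      have h2 := hb0 ⟨a, rfl⟩
      have h3 := hsub a b
      have h4 := hsub i b
      omega
    refine hne (Prod.ext (funext hc) (funext fun j => ?_))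
    obtain ⟨i, rfl⟩ := T.surjective j
    have := WithBot.coe_inj.1 ((hyT i).symm.trans (hzT i))
    have := hc i
    omega
  · rintro ⟨i, k, h⟩
    have : Nonempty ι := ⟨i⟩
    obtain ⟨y, hy, hyx⟩ := SignatureMatrix.exists_normalisedOffset
      (SignatureMatrix.mem_generalOffsets_iff.2 ⟨hx, T, hT⟩)
    obtain ⟨z, hz, hzx⟩ := SignatureMatrix.exists_normalisedOffset_shift hx hT
      (U := {a | (Sig.jacobianPattern x).Reach T i a}) (i := i) (k := k) .refl h zero_le_one
      fun a ha b hb => hx.entry_le_sub_one fun hab => hb (.tail ha hab)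
    refine ⟨y, hy, z, hz, ?_⟩
    rintro rfl
    have := hyx i k
    omega

theorem SignatureMatrix.normalisedOffsets_infinite_iff (hx : Sig.Feasible x)
    (hT : Sig.Tight x T) : Sig.normalisedOffsets.Infinite ↔
      ∃ i k, ¬ Sig.pattern.Reach T i k := by
  constructor
  · contrapose!
    intro h
    choose L hL using fun i k => SignatureMatrix.exists_le_sub_of_reach (h i k)
    -- Some row `a` has offset 0, so `y.1 i ≤ -L i a`; summing over all `k` makes the bound
    -- independent of `a`.
    let M : ι → ℤ := fun i => ∑ k, |L i k|
    have hM : ∀ y ∈ Sig.normalisedOffsets, y.1 ∈ Set.Icc 0 M := by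
      rintro y ⟨hy, ⟨a, ha⟩, hy0⟩
      refine ⟨fun i => hy0 ⟨i, rfl⟩, fun i => ?_⟩
      have h1 := hL i a y hy.1 (SignatureMatrix.tight_of_mem_generalOffsets hx hT hy)
      have h2 : |L i a| ≤ M i :=
        Finset.single_le_sum (f := fun k => |L i k|) (fun _ _ => abs_nonneg _) (Finset.mem_univ a)
      have h3 := neg_abs_le (L i a)
      change y.1 i ≤ M i
      omega
    classical
    refine Set.Finite.of_injOn hM (fun y hy z hz hyz => Prod.ext hyz (funext fun j => ?_))
      (Set.finite_Icc 0 M)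
    obtain ⟨i, rfl⟩ := T.surjective j
    have h1 := WithBot.coe_inj.1
      ((SignatureMatrix.tight_of_mem_generalOffsets hx hT hy.1 i).symm.trans
        (SignatureMatrix.tight_of_mem_generalOffsets hx hT hz.1 i))
    have h2 := congrFun hyz i
    omega
  · rintro ⟨i, k, h⟩
    have hshift : ∀ m : ℕ, ∃ y ∈ Sig.normalisedOffsets, y.1 i - y.1 k = x.1 i - x.1 k + m :=
      fun m => SignatureMatrix.exists_normalisedOffset_shift hx hT
        (U := {a | Sig.pattern.Reach T i a}) .refl h (Int.natCast_nonneg m) fun a ha b hb => by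
          have : Sig.entry a (T b) = ⊥ := by
            by_contra hab
            exact hb (.tail ha (mt SignatureMatrix.entry_eq_bot_iff.2 hab))
          rw [this]
          exact bot_le
    choose y hy hyx using hshift
    refine Set.infinite_of_injective_forall_mem (f := y) (fun m m' hm => ?_) hy
    have h1 := hyx m
    have h2 := hyx m'
    rw [hm] at h1
    omega

/-- The graph is the row digraph of `S` with each strong component of `S₀(x)` contracted; as these
are already strongly connected in `S`, paths lift and project. -/
theorem SignatureMatrix.strongComponents_nontrivial_iff (hx : Sig.Feasible x)
    (hT : Sig.Tight x T) (hx0 : ∀ i, 0 ≤ x.1 i) :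
    Sig.fineBlockGraph.strongComponents.Nontrivial ↔ ∃ i k, ¬ Sig.pattern.Reach T i k := by
  have hS : ∀ {i k}, (Sig.jacobianPattern x).Reach T i k → Sig.pattern.Reach T i k :=
    fun {i k} h => Relation.ReflTransGen.mono
      (fun _ _ h => SignatureMatrix.jacobianPattern_subset_pattern h) _ _ h
  have hblocks := SignatureMatrix.fineBlocks_eq_range hx hT hx0
  have hin : ∀ u : Sig.fineBlocks, ∃ i, (Sig.jacobianPattern x).strongBlock T i = u.1 := fun u =>
    hblocks.le u.2
  have hfwd : ∀ u w, Sig.fineBlockGraph.ReachableFrom u w → ∀ i ∈ u.1.1, ∀ k ∈ w.1.1,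
      Sig.pattern.Reach T i k := by
    have hsame : ∀ u : Sig.fineBlocks, ∀ i ∈ u.1.1, ∀ k ∈ u.1.1, Sig.pattern.Reach T i k := by
      intro u i hi k hk
      obtain ⟨a, ha⟩ := hin u
      rw [← ha] at hi hk
      exact hS (hi.2.trans hk.1)
    intro u w h i hi
    induction h with
    | refl => exact hsame u i hi
    | @tail v w _ h ih =>
      obtain ⟨_, a, ha, j, hj, haj⟩ := (SignatureMatrix.fineBlockGraph_adj_iff _ _ _).1 h
      obtain ⟨b, rfl⟩ := T.surjective j
      have hb : b ∈ w.1.1 := by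
        obtain ⟨c, hc⟩ := hin w
        rw [← hc] at hj ⊢
        simpa [Pattern.strongBlock] using hj
      exact fun k hk => .trans (.tail (ih a ha) haj) (hsame w b hb k hk)
  let v : ι → Sig.fineBlocks := fun i => ⟨(Sig.jacobianPattern x).strongBlock T i,
    hblocks.ge ⟨i, rfl⟩⟩
  have hbwd : ∀ i k, Sig.pattern.Reach T i k → Sig.fineBlockGraph.ReachableFrom (v i) (v k) := by
    intro i k h
    induction h with
    | refl => exact .refl
    | @tail a b _ h ih =>
      by_cases hab : v a = v b
      · rwa [← hab]
      · refine .tail ih ((SignatureMatrix.fineBlockGraph_adj_iff _ _ _).2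
          ⟨hab, a, ⟨.refl, .refl⟩, T b, ?_, h⟩)
        have hb : (Sig.jacobianPattern x).Reach T b b := .refl
        simpa [v, Pattern.strongBlock] using hb
  rw [Digraph.strongComponents_nontrivial_iff]
  constructor
  · rintro ⟨u, w, h⟩
    obtain ⟨i, hi⟩ := hin u
    obtain ⟨k, hk⟩ := hin w
    obtain rfl : v i = u := Subtype.ext hi
    obtain rfl : v k = w := Subtype.ext hk
    exact ⟨i, k, mt (hbwd i k) h⟩
  · rintro ⟨i, k, h⟩
    exact ⟨v i, v k, fun h' => h (hfwd _ _ h' i ⟨.refl, .refl⟩ k ⟨.refl, .refl⟩)⟩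

end Blocks

end SigmaMethod

theorem mainTheorem3 (n : ℕ) (hn : 0 < n) (Sig : SigmaMethod.SignatureMatrix (Fin n) (Fin n))
    (hSig : Sig.StructurallyWellPosed) :
    ((Sig.normalisedOffsets.Nontrivial ↔ Nontrivial Sig.fineBlocks) ∧
      (Nontrivial Sig.fineBlocks ↔ ¬ Sig.FineBlockIrreducible)) ∧
    ((Sig.normalisedOffsets.Infinite ↔ Sig.fineBlockGraph.strongComponents.Nontrivial) ∧
      (Sig.fineBlockGraph.strongComponents.Nontrivial ↔ ¬ Sig.CoarseBlockIrreducible)) := by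
  have : Nonempty (Fin n) := ⟨⟨0, hn⟩⟩
  obtain ⟨_, hg⟩ := hSig.generalOffsets_nonempty
  -- Normalising makes the vector valid, as needed to read off the fine blocks.
  obtain ⟨x, ⟨hx, hx0⟩, -⟩ := SigmaMethod.SignatureMatrix.exists_normalisedOffset hg
  obtain ⟨hf, T, hT⟩ := SigmaMethod.SignatureMatrix.mem_generalOffsets_iff.1 hx
  have hx0 : ∀ i, 0 ≤ x.1 i := fun i => hx0.2 ⟨i, rfl⟩
  have hfine := SigmaMethod.SignatureMatrix.fineBlocks_eq_range hf hT hx0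
  have hcoarse := SigmaMethod.SignatureMatrix.coarseBlocks_eq_range hT
  rw [Set.nontrivial_coe_sort, SigmaMethod.SignatureMatrix.normalisedOffsets_nontrivial_iff hf hT,
    SigmaMethod.SignatureMatrix.normalisedOffsets_infinite_iff hf hT,
    SigmaMethod.SignatureMatrix.strongComponents_nontrivial_iff hf hT hx0]
  refine ⟨⟨?_, ?_⟩, Iff.rfl, ?_⟩
  · rw [hfine, SigmaMethod.Pattern.nontrivial_range_strongBlock_iff]
  · exact Set.Nonempty.nontrivial_iff_not_existsUnique (hfine ▸ Set.range_nonempty _)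
  · rw [← SigmaMethod.Pattern.nontrivial_range_strongBlock_iff, ← hcoarse]
    exact Set.Nonempty.nontrivial_iff_not_existsUnique (hcoarse ▸ Set.range_nonempty _)
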